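/- Let $m,n\ge 2$ and let $(A,f,g)$ be a commutative Krasner $(m,n)$-hyperring with scalar identity $1$. That is: $(A,f)$ is a canonical $m$-ary hypergroup, meaning a commutative associative $m$-ary hyperoperation with non-empty values in which $b\in f(a_1,\dots,a_{i-1},x,a_{i+1},\dots,a_m)$ is always solvable for $x$, with a unique element $0$ such that $f(x,0^{(m-1)})=\{x\}$ for all $x$, with for every $x$ a unique $-x$ such that $0\in f(x,-x,0^{(m-2)})$, and such that $x\in f(a_1,\dots,a_m)$ implies $a_i\in f(x,-a_1,\dots,\widehat{-a_i},\dots,-a_m)$ for every $i$; $(A,g)$ is a commutative $n$-ary semigroup; $g$ is distributive in each argument over $f$; $g(\dots,0,\dots)=0$; and $g$ takes the value $x$ whenever one argument is $x$ and all the others are $1$. Here $a^{(k)}$ denotes $a$ repeated $k$ times. A hyperideal of $A$ is a non-empty $Q\subseteq A$ such that $(Q,f)$ is an $m$-ary hypergroup and $g(x_1,\dots,x_{i-1},q,x_{i+1},\dots,x_n)\in Q$ whenever $q\in Q$, $x_j\in A$ and $1\le i\le n$. A hyperideal $P\ne A$ is prime if, for all hyperideals $Q_1,\dots,Q_n$,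 the inclusion $g(Q_1,\dots,Q_n)\subseteq P$ implies $Q_i\subseteq P$ for some $i$; $\mathrm{rad}(Q)$ is the intersection of all prime hyperideals containing $Q$ (and $A$ if there are none). A non-empty $S\subseteq A$ is $n$-ary multiplicative if $g(s_1,\dots,s_n)\in S$ for all $s_1,\dots,s_n\in S$. A hyperideal $Q$ is weakly $n$-ary $S$-primary, for an $n$-ary multiplicative set $S$ with $Q\cap S=\varnothing$, if there is $s\in S$ such that for all $a_1,\dots,a_n\in A$ with $0\ne g(a_1,\dots,a_n)\in Q$ there is $i\in\{1,\dots,n\}$ with $g(s,a_i,1^{(n-2)})\in Q$ or $g(a_1,\dots,a_{i-1},s,a_{i+1},\dots,a_n)\in\mathrm{rad}(Q)$. For an $n$-ary multiplicative set $S$ with $1\in S$, $S^{-1}A$ is the set of classes $a/s$ of pairs $(a,s)\in A\times S$, where $a/s=b/t$ iff $0\in g\big(u,f(g(a,t,1^{(n-2)}),-g(b,s,1^{(n-2)}),0^{(m-2)}),1^{(n-2)}\big)$ for some $u\in S$, with the $n$-ary operation $G(a_1/s_1,\dots,a_n/s_n)=g(a_1,\dots,a_n)/g(s_1,\dots,s_n)$;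 an element $\alpha$ of $S^{-1}A$ is invertible if $G(\alpha,\beta,(1/1)^{(n-2)})=1/1$ for some $\beta\in S^{-1}A$. **Theorem.** Let $S\subseteq A$ be an $n$-ary multiplicative set and $Q$ a hyperideal of $A$ such that $1\in S$ and $S\cap Q=\varnothing$, and let $S'=\{x\in A : x/1 \text{ is invertible in } S^{-1}A\}$. Then $Q$ is a weakly $n$-ary $S$-primary hyperideal of $A$ if and only if $Q$ is a weakly $n$-ary $S'$-primary hyperideal of $A$ (in particular, in that case $S'$ is $n$-ary multiplicative and $Q\cap S'=\varnothing$). -/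

import Mathlib

namespace NaryHyper

/-- The `k`-tuple `(a, b, c, …, c)`, written `(a, b, c^{(k-2)})`. -/
def pad {A : Type*} (k : ℕ) (a b c : A) : Fin k → A :=
  fun j => if j.val = 0 then a else if j.val = 1 then b else c

/-- Extension of a `k`-ary hyperoperation to subsets:
`f(U₁, …, U_k) = ⋃ { f(x₁, …, x_k) | xᵢ ∈ Uᵢ }`. -/
def hyperLift {A : Type*} {k : ℕ} (f : (Fin k → A) → Set A) (U : Fin k → Set A) : Set A :=
  {y | ∃ x : Fin k → A, (∀ j, x j ∈ U j) ∧ y ∈ f x}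

/-- Extension of a `k`-ary operation to subsets. -/
def opLift {A : Type*} {k : ℕ} (g : (Fin k → A) → A) (U : Fin k → Set A) : Set A :=
  {y | ∃ x : Fin k → A, (∀ j, x j ∈ U j) ∧ y = g x}

/-- Associativity of a `k`-ary hyperoperation: in `x₀, …, x_{2k-2}` the inner block of length `k`
may start at any position `i < k`. Only the first `2k - 1` entries of the sequence matter. -/
def HyperAssoc {A : Type*} {k : ℕ} (f : (Fin k → A) → Set A) : Prop :=
  ∀ (x : ℕ → A) (i j : Fin k),
    hyperLift f (fun p : Fin k => if p.val < i.val then {x p.val} else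
        if p.val = i.val then f (fun l : Fin k => x (i.val + l.val)) else {x (p.val + k - 1)}) =
    hyperLift f (fun p : Fin k => if p.val < j.val then {x p.val} else
        if p.val = j.val then f (fun l : Fin k => x (j.val + l.val)) else {x (p.val + k - 1)})

/-- Associativity of a `k`-ary operation. -/
def OpAssoc {A : Type*} {k : ℕ} (g : (Fin k → A) → A) : Prop :=
  ∀ (x : ℕ → A) (i j : Fin k),
    g (fun p : Fin k => if p.val < i.val then x p.val else
        if p.val = i.val then g (fun l : Fin k => x (i.val + l.val)) else x (p.val + k - 1)) =
    g (fun p : Fin k => if p.val < j.val then x p.val else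
        if p.val = j.val then g (fun l : Fin k => x (j.val + l.val)) else x (p.val + k - 1))

/-- An element `x` is invertible for an `n`-ary operation `g` with identity `e` if
`e = g(x, y, e^{(n-2)})` for some `y`. -/
def IsInvertible {A : Type*} {n : ℕ} (g : (Fin n → A) → A) (e x : A) : Prop :=
  ∃ y : A, e = g (pad n x y e)

/-- A commutative Krasner `(m, n)`-hyperring `(A, f, g)` with scalar identity `one`. -/
structure KrasnerHyperring (m n : ℕ) (A : Type*) where
  two_le_m : 2 ≤ m
  two_le_n : 2 ≤ n
  /-- the `m`-ary hyperoperation -/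
  f : (Fin m → A) → Set A
  /-- the `n`-ary operation -/
  g : (Fin n → A) → A
  zero : A
  neg : A → A
  one : A
  -- `(A, f)` is a commutative `m`-ary hypergroup
  f_nonempty : ∀ x, (f x).Nonempty
  f_comm : ∀ (x : Fin m → A) (σ : Equiv.Perm (Fin m)), f (x ∘ σ) = f x
  f_assoc : HyperAssoc f
  f_solvable : ∀ (a : Fin m → A) (i : Fin m) (b : A), ∃ x, b ∈ f (Function.update a i x)
  -- which is canonical
  f_zero : ∀ x, f (pad m x zero zero) = {x}
  zero_unique : ∀ e, (∀ x, f (pad m x e e) = {x}) → e = zero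
  zero_mem_f_neg : ∀ x, zero ∈ f (pad m x (neg x) zero)
  neg_unique : ∀ x y, zero ∈ f (pad m x y zero) → y = neg x
  -- as `f` is commutative, `x` may stand at the position of the omitted entry
  f_reversible : ∀ (a : Fin m → A) (x : A), x ∈ f a →
    ∀ i, a i ∈ f (Function.update (fun j => neg (a j)) i x)
  -- `(A, g)` is a commutative `n`-ary semigroup
  g_comm : ∀ (x : Fin n → A) (σ : Equiv.Perm (Fin n)), g (x ∘ σ) = g x
  g_assoc : OpAssoc g
  -- distributivity
  g_f_distrib : ∀ (a : Fin n → A) (i : Fin n) (x : Fin m → A),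
    (fun z => g (Function.update a i z)) '' f x = f (fun j => g (Function.update a i (x j)))
  -- `zero` is absorbing
  g_zero : ∀ (a : Fin n → A) (i : Fin n), g (Function.update a i zero) = zero
  -- `one` is a scalar identity
  g_one : ∀ (x : A) (i : Fin n), g (Function.update (fun _ => one) i x) = x

namespace KrasnerHyperring

variable {m n : ℕ} {A : Type*} (R : KrasnerHyperring m n A)

/-- `(Q, f)` is an `m`-ary subhypergroup of `(A, f)`, that is, an `m`-ary hypergroup under the
restriction of `f` (associativity is inherited). -/
def IsSubhypergroup (Q : Set A) : Prop :=
  Q.Nonempty ∧ (∀ x : Fin m → A, (∀ j, x j ∈ Q) → R.f x ⊆ Q) ∧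
    ∀ (a : Fin m → A) (i : Fin m) (b : A), (∀ j, a j ∈ Q) → b ∈ Q →
      ∃ x ∈ Q, b ∈ R.f (Function.update a i x)

def IsHyperideal (Q : Set A) : Prop :=
  R.IsSubhypergroup Q ∧
    ∀ (x : Fin n → A) (i : Fin n) (q : A), q ∈ Q → R.g (Function.update x i q) ∈ Q

def IsPrimeHyperideal (P : Set A) : Prop :=
  R.IsHyperideal P ∧ P ≠ Set.univ ∧
    ∀ Q : Fin n → Set A, (∀ i, R.IsHyperideal (Q i)) → opLift R.g Q ⊆ P → ∃ i, Q i ⊆ P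

/-- The radical: the intersection of all prime hyperideals containing `Q` (all of `A` if there is
none). -/
def rad (Q : Set A) : Set A :=
  ⋂₀ {P | R.IsPrimeHyperideal P ∧ Q ⊆ P}

/-- `n`-ary multiplicative subsets. -/
def IsMultiplicative (S : Set A) : Prop :=
  S.Nonempty ∧ ∀ s : Fin n → A, (∀ i, s i ∈ S) → R.g s ∈ S

/-- Weakly `n`-ary `S`-primary hyperideals. -/
def IsWeaklyPrimary (S Q : Set A) : Prop :=
  R.IsHyperideal Q ∧ R.IsMultiplicative S ∧ Q ∩ S = ∅ ∧
    ∃ s ∈ S, ∀ a : Fin n → A, R.g a ≠ R.zero → R.g a ∈ Q →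
      ∃ i : Fin n, R.g (pad n s (a i) R.one) ∈ Q ∨ R.g (Function.update a i s) ∈ R.rad Q

/-- The relation defining fractions: `(a, s) ∼ (b, t)` if
`0 ∈ g(u, f(g(a, t, 1^{(n-2)}), -g(b, s, 1^{(n-2)}), 0^{(m-2)}), 1^{(n-2)})` for some `u ∈ S`. -/
def FracRel (S : Set A) (p q : A × S) : Prop :=
  ∃ u ∈ S, R.zero ∈ (fun z => R.g (pad n u z R.one)) ''
    R.f (pad m (R.g (pad n p.1 q.2 R.one)) (R.neg (R.g (pad n q.1 p.2 R.one))) R.zero)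

/-! Helper facts: `g` is the iterated product of a commutative monoid, and `FracRel` is an
equivalence relation compatible with `g`. -/

theorem pad_eq_update (hn : 2 ≤ n) (a b c : A) :
    pad n a b c = Function.update (Function.update (fun _ => c) ⟨0, by omega⟩ a) ⟨1, by omega⟩ b := by
  funext j
  rcases j with ⟨j, hj⟩
  simp only [pad, Function.update_apply, Fin.mk.injEq]
  split_ifs <;> first | rfl | omega

theorem pad_one_right (x : A) : R.g (pad n x R.one R.one) = x := by
  have h := R.two_le_n
  have e := R.g_one x ⟨0, by omega⟩
  have : pad n x R.one R.one = Function.update (fun _ => R.one) ⟨0, by omega⟩ x := by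
    funext j
    rcases j with ⟨j, hj⟩
    simp only [pad, Function.update_apply, Fin.mk.injEq]
    split_ifs <;> rfl
  rw [this, e]

theorem pad_comm (x y : A) : R.g (pad n x y R.one) = R.g (pad n y x R.one) := by
  have h := R.two_le_n
  rw [← R.g_comm (pad n x y R.one) (Equiv.swap ⟨0, by omega⟩ ⟨1, by omega⟩)]
  congr 1
  funext j
  rcases j with ⟨j, hj⟩
  simp only [pad, Function.comp, Equiv.swap_apply_def, Fin.mk.injEq]
  split_ifs <;> simp_all

theorem g_prefix_succ (a : ℕ → A) (k : ℕ) (hk : k < n) :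
    R.g (fun p : Fin n => if p.val < k + 1 then a p.val else R.one) =
      R.g (pad n (R.g (fun p : Fin n => if p.val < k then a p.val else R.one)) (a k) R.one) := by
  have h := R.two_le_n
  rcases Nat.eq_zero_or_pos k with rfl | hk0
  · have e1 : R.g (fun p : Fin n => if p.val < 0 then a p.val else R.one) = R.one := by
      have e := R.g_one R.one ⟨0, by omega⟩
      rw [Function.update_eq_self_iff.mpr rfl] at e
      simpa using e
    rw [e1, pad_comm, pad_one_right]
    conv_rhs => rw [← R.pad_one_right (a 0)]
    congr 1
    funext j
    rcases j with ⟨j, hj⟩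
    simp only [pad]
    split_ifs <;> first | rfl | omega | simp_all
  · have e := R.g_assoc
      (fun p => if p < k then a p else if p = n then a k else R.one) ⟨0, by omega⟩ ⟨k, hk⟩
    have e2 : R.g (fun l : Fin n => if k + l.val < k then a (k + l.val) else
        if k + l.val = n then a k else R.one) = a k := by
      rw [← R.g_one (a k) ⟨n - k, by omega⟩]
      congr 1
      funext j
      rcases j with ⟨j, hj⟩
      simp only [Function.update_apply, Fin.mk.injEq]
      rw [R.g_one]
      split_ifs <;> first | rfl | omega
    dsimp only at e
    rw [e2] at e
    refine Eq.trans ?_ (Eq.trans e.symm ?_)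
    · congr 1
      funext j
      rcases j with ⟨j, hj⟩
      dsimp only
      split_ifs <;> first | rfl | omega | (subst_vars; rfl)
    · congr 1
      funext j
      rcases j with ⟨j, hj⟩
      simp only [pad, Nat.zero_add]
      split_ifs <;> first | rfl | omega | skip
      · congr 1
        funext l
        rcases l with ⟨l, hl⟩
        dsimp only
        split_ifs <;> first | rfl | omega

theorem pad_assoc (x y z : A) :
    R.g (pad n (R.g (pad n x y R.one)) z R.one) = R.g (pad n x (R.g (pad n y z R.one)) R.one) := by
  have h := R.two_le_n
  have e := R.g_assoc
    (fun p => if p = 0 then x else if p = 1 then y else if p = n then z else R.one)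
    ⟨0, by omega⟩ ⟨1, by omega⟩
  refine Eq.trans ?_ (e.trans ?_)
  · congr 1
    funext j
    rcases j with ⟨j, hj⟩
    simp only [pad, Nat.zero_add]
    split_ifs <;> first | rfl | omega | skip
    · congr 1
      funext l
      rcases l with ⟨l, hl⟩
      simp only [pad]
      split_ifs <;> first | rfl | omega
  · have e3 : R.g (fun l : Fin n => if 1 + l.val = 0 then x else if 1 + l.val = 1 then y else
        if 1 + l.val = n then z else R.one) = R.g (pad n y z R.one) := by
      rw [← R.g_comm (pad n y z R.one) (Equiv.swap ⟨1, by omega⟩ ⟨n - 1, by omega⟩)]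
      congr 1
      funext j
      rcases j with ⟨j, hj⟩
      simp only [pad, Function.comp, Equiv.swap_apply_def, Fin.mk.injEq, apply_ite Fin.val]
      split_ifs <;> first | rfl | omega | contradiction
    dsimp only
    rw [e3]
    congr 1
    funext j
    rcases j with ⟨j, hj⟩
    simp only [pad]
    split_ifs <;> first | rfl | omega

/-- The commutative monoid `x * y = g(x, y, 1^{(n-2)})`. -/
abbrev toCommMonoid : CommMonoid A where
  mul x y := R.g (pad n x y R.one)
  one := R.one
  mul_assoc := R.pad_assoc
  mul_comm := R.pad_comm
  mul_one := R.pad_one_right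
  one_mul x := (R.pad_comm _ _).trans (R.pad_one_right x)

theorem g_eq_prod (a : Fin n → A) :
    letI := R.toCommMonoid
    R.g a = ∏ i, a i := by
  let _ := R.toCommMonoid
  have h := R.two_le_n
  let b : ℕ → A := fun p => if hp : p < n then a ⟨p, hp⟩ else R.one
  have key : ∀ k, k ≤ n → R.g (fun p : Fin n => if p.val < k then b p.val else R.one) =
      ∏ p ∈ Finset.range k, b p := by
    intro k
    induction k with
    | zero =>
      intro _
      have e := R.g_one R.one ⟨0, by omega⟩
      rw [Function.update_eq_self_iff.mpr rfl] at e
      simpa using (show R.g (fun _ => R.one) = 1 from e)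
    | succ k ih =>
      intro hk
      rw [R.g_prefix_succ b k (by omega), ih (by omega), Finset.prod_range_succ]
      rfl
  have e := key n le_rfl
  rw [Finset.prod_range] at e
  simpa [b] using e

theorem neg_g_pad (u y : A) : R.g (pad n u (R.neg y) R.one) = R.neg (R.g (pad n u y R.one)) := by
  have hn := R.two_le_n
  have hm := R.two_le_m
  apply R.neg_unique
  have h0 : ∀ z, R.g (pad n u z R.one) =
      R.g (Function.update (Function.update (fun _ => R.one) ⟨0, by omega⟩ u) ⟨1, by omega⟩ z) := by
    intro z
    rw [pad_eq_update hn]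
  have hd := R.g_f_distrib (Function.update (fun _ => R.one) ⟨0, by omega⟩ u) ⟨1, by omega⟩
    (pad m y (R.neg y) R.zero)
  simp only [← h0] at hd
  have hz : R.g (pad n u R.zero R.one) = R.zero := by rw [h0, R.g_zero]
  have hp : (fun j => R.g (pad n u (pad m y (R.neg y) R.zero j) R.one)) =
      pad m (R.g (pad n u y R.one)) (R.g (pad n u (R.neg y) R.one)) R.zero := by
    funext j
    simp only [pad]
    split_ifs <;> first | rfl | exact hz
  rw [hp] at hd
  rw [← hd]
  exact ⟨R.zero, R.zero_mem_f_neg y, hz⟩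

theorem f_pad_swap (x y : A) : R.f (pad m x y R.zero) = R.f (pad m y x R.zero) := by
  have h := R.two_le_m
  rw [← R.f_comm (pad m x y R.zero) (Equiv.swap ⟨0, by omega⟩ ⟨1, by omega⟩)]
  congr 1
  funext j
  rcases j with ⟨j, hj⟩
  simp only [pad, Function.comp, Equiv.swap_apply_def, Fin.mk.injEq]
  split_ifs <;> simp_all

theorem zero_mem_f_sub (x y : A) : R.zero ∈ R.f (pad m x (R.neg y) R.zero) ↔ x = y := by
  constructor
  · intro h
    rw [f_pad_swap] at h
    have h1 := R.neg_unique _ _ h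
    have h2 := R.zero_mem_f_neg y
    rw [f_pad_swap] at h2
    rw [h1, ← R.neg_unique _ _ h2]
  · rintro rfl
    exact R.zero_mem_f_neg x

theorem fracRel_iff (S : Set A) (p q : A × S) :
    letI := R.toCommMonoid
    R.FracRel S p q ↔ ∃ u ∈ S, u * (p.1 * (q.2 : A)) = u * (q.1 * (p.2 : A)) := by
  let _ := R.toCommMonoid
  have hn := R.two_le_n
  unfold FracRel
  refine exists_congr fun u => and_congr_right fun _ => ?_
  have h0 : ∀ z, R.g (pad n u z R.one) =
      R.g (Function.update (Function.update (fun _ => R.one) ⟨0, by omega⟩ u) ⟨1, by omega⟩ z) := by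
    intro z
    rw [pad_eq_update hn]
  have hd := R.g_f_distrib (Function.update (fun _ => R.one) ⟨0, by omega⟩ u) ⟨1, by omega⟩
    (pad m (R.g (pad n p.1 q.2 R.one)) (R.neg (R.g (pad n q.1 p.2 R.one))) R.zero)
  simp only [← h0] at hd
  have hz : R.g (pad n u R.zero R.one) = R.zero := by rw [h0, R.g_zero]
  have hp : (fun j => R.g (pad n u (pad m (R.g (pad n p.1 q.2 R.one))
      (R.neg (R.g (pad n q.1 p.2 R.one))) R.zero j) R.one)) =
      pad m (R.g (pad n u (R.g (pad n p.1 q.2 R.one)) R.one))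
        (R.neg (R.g (pad n u (R.g (pad n q.1 p.2 R.one)) R.one))) R.zero := by
    funext j
    rw [← R.neg_g_pad u]
    simp only [pad]
    split_ifs <;> first | rfl | exact hz
  rw [hd, hp, zero_mem_f_sub]
  rfl

theorem fracRel_equivalence {S : Set A} (hS : R.IsMultiplicative S) (h1 : R.one ∈ S) :
    Equivalence (R.FracRel S) := by
  let _ := R.toCommMonoid
  have hmul : ∀ x ∈ S, ∀ y ∈ S, x * y ∈ S := by
    intro x hx y hy
    refine hS.2 _ fun i => ?_
    simp only [pad]
    split_ifs <;> assumption
  refine ⟨fun p => (R.fracRel_iff S p p).2 ⟨R.one, h1, rfl⟩, ?_, ?_⟩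
  · intro p q h
    obtain ⟨u, hu, e⟩ := (R.fracRel_iff S p q).1 h
    exact (R.fracRel_iff S q p).2 ⟨u, hu, e.symm⟩
  · rintro ⟨a, s⟩ ⟨b, t⟩ ⟨c, r⟩ h h'
    obtain ⟨u, hu, e⟩ := (R.fracRel_iff S _ _).1 h
    obtain ⟨v, hv, e'⟩ := (R.fracRel_iff S _ _).1 h'
    refine (R.fracRel_iff S _ _).2 ⟨u * v * t, hmul _ (hmul _ hu _ hv) _ t.2, ?_⟩
    dsimp only at e e' ⊢
    calc u * v * t * (a * r) = (u * (a * t)) * (v * r) := by ac_rfl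
      _ = (u * (b * s)) * (v * r) := by rw [e]
      _ = (v * (b * r)) * (u * s) := by ac_rfl
      _ = (v * (c * t)) * (u * s) := by rw [e']
      _ = u * v * t * (c * s) := by ac_rfl

/-- The setoid of fractions on `A × S`. -/
def fracSetoid (S : Set A) (hS : R.IsMultiplicative S) (h1 : R.one ∈ S) : Setoid (A × S) where
  r := R.FracRel S
  iseqv := R.fracRel_equivalence hS h1

/-- `S⁻¹A`. -/
def Frac (S : Set A) (hS : R.IsMultiplicative S) (h1 : R.one ∈ S) :=
  Quotient (R.fracSetoid S hS h1)

/-- The fraction `a / s`. -/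
def mkFrac (S : Set A) (hS : R.IsMultiplicative S) (h1 : R.one ∈ S) (a : A) (s : S) :
    R.Frac S hS h1 :=
  Quotient.mk (R.fracSetoid S hS h1) (a, s)

/-- `(g(a₁, …, a_n), g(s₁, …, s_n))` for pairs `(aᵢ, sᵢ)`. -/
def gPair (S : Set A) (hS : R.IsMultiplicative S) (p : Fin n → A × S) : A × S :=
  (R.g (fun i => (p i).1), ⟨R.g (fun i => ((p i).2 : A)), hS.2 _ fun i => (p i).2.2⟩)

theorem gPair_congr (S : Set A) (hS : R.IsMultiplicative S) (p q : Fin n → A × S)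
    (h : ∀ i, R.FracRel S (p i) (q i)) : R.FracRel S (R.gPair S hS p) (R.gPair S hS q) := by
  let _ := R.toCommMonoid
  choose u hu e using fun i => (R.fracRel_iff S (p i) (q i)).1 (h i)
  refine (R.fracRel_iff S _ _).2 ⟨R.g u, hS.2 u hu, ?_⟩
  simp only [gPair, R.g_eq_prod, ← Finset.prod_mul_distrib]
  exact Finset.prod_congr rfl fun i _ => e i

/-- The `n`-ary operation of `S⁻¹A`: `G(a₁/s₁, …, a_n/s_n) = g(a₁, …, a_n)/g(s₁, …, s_n)`. -/
def fracG (S : Set A) (hS : R.IsMultiplicative S) (h1 : R.one ∈ S)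
    (x : Fin n → R.Frac S hS h1) : R.Frac S hS h1 :=
  Quotient.finLiftOn (S := fun _ => R.fracSetoid S hS h1) x
    (fun p => Quotient.mk (R.fracSetoid S hS h1) (R.gPair S hS p))
    (fun p q h => Quotient.sound (s := R.fracSetoid S hS h1) (R.gPair_congr S hS p q h))

/-- The scalar identity `1/1` of `S⁻¹A`. -/
def fracOne (S : Set A) (hS : R.IsMultiplicative S) (h1 : R.one ∈ S) : R.Frac S hS h1 :=
  R.mkFrac S hS h1 R.one ⟨R.one, h1⟩

theorem fracG_mkFrac (S : Set A) (hS : R.IsMultiplicative S) (h1 : R.one ∈ S)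
    (a : Fin n → A) (s : Fin n → S) :
    R.fracG S hS h1 (fun i => R.mkFrac S hS h1 (a i) (s i)) =
      R.mkFrac S hS h1 (R.g a) ⟨R.g (fun i => (s i : A)), hS.2 _ fun i => (s i).2⟩ :=
  congrFun (congrFun (Quotient.finLiftOn_mk (S := fun _ => R.fracSetoid S hS h1)
    (fun i => (a i, s i))) _) _

/-- `S' = {x ∈ A | x/1 is invertible in S⁻¹A}`; invertibility in `S⁻¹A` involves only its `n`-ary
operation and its identity. -/
def saturation (S : Set A) (hS : R.IsMultiplicative S) (h1 : R.one ∈ S) : Set A :=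
  {x | IsInvertible (R.fracG S hS h1) (R.fracOne S hS h1) (R.mkFrac S hS h1 x ⟨R.one, h1⟩)}

end KrasnerHyperring

end NaryHyper

namespace NaryHyper

namespace KrasnerHyperring

variable {m n : ℕ} {A : Type*} (R : KrasnerHyperring m n A)

/-! Write `x * y` for `g(x, y, 1^{(n-2)})`; this is a commutative monoid and `g` is its iterated
product. In a canonical hypergroup `0 ∈ x - y` means `x = y`, so equality of fractions is the usual
localization relation and the argument is purely multiplicative. The key is `mem_saturation_iff`:
`x/1` is invertible exactly when `x` divides an element of `S`. Hence `S ⊆ S'`, and `S'` is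
multiplicative and still misses `Q`, so a witness `s ∈ S` also serves for `S'`. Conversely, a
witness `s ∈ S'` has a multiple `s * y ∈ S`. This multiple is again a witness: both alternatives of
the primary condition place a product containing `s` in `Q` or `rad Q`, and both sets absorb the
extra factor `y`. -/

theorem mkFrac_eq_iff {S : Set A} (hS : R.IsMultiplicative S) (h1 : R.one ∈ S)
    (a b : A) (s t : S) :
    letI := R.toCommMonoid
    R.mkFrac S hS h1 a s = R.mkFrac S hS h1 b t ↔ ∃ u ∈ S, u * (a * t) = u * (b * s) := by
  let _ := R.toCommMonoid
  refine Iff.trans ?_ (R.fracRel_iff S (a, s) (b, t))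
  exact Quotient.eq (r := R.fracSetoid S hS h1)

theorem fracG_pad_mkFrac {S : Set A} (hS : R.IsMultiplicative S) (h1 : R.one ∈ S)
    (a b c : A) (s t r : S) :
    R.fracG S hS h1
        (pad n (R.mkFrac S hS h1 a s) (R.mkFrac S hS h1 b t) (R.mkFrac S hS h1 c r)) =
      R.mkFrac S hS h1 (R.g (pad n a b c))
        ⟨R.g (fun i => ((pad n s t r i : S) : A)), hS.2 _ fun i => (pad n s t r i).2⟩ := by
  rw [← R.fracG_mkFrac S hS h1]
  congr 1
  funext j
  simp only [pad]
  split_ifs <;> rfl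

variable {R}

theorem IsMultiplicative.mul_mem {S : Set A} (hS : R.IsMultiplicative S) {x y : A}
    (hx : x ∈ S) (hy : y ∈ S) (h1 : R.one ∈ S) : R.g (pad n x y R.one) ∈ S := by
  refine hS.2 _ fun i => ?_
  simp only [pad]
  split_ifs <;> assumption

/-- `S'` consists of the divisors of elements of `S`. -/
theorem mem_saturation_iff {S : Set A} (hS : R.IsMultiplicative S) (h1 : R.one ∈ S) (x : A) :
    x ∈ R.saturation S hS h1 ↔ ∃ y, R.g (pad n x y R.one) ∈ S := by
  let _ := R.toCommMonoid
  -- The denominator of `G(x/1, y/t, 1/1, …, 1/1)` is just `t`.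
  have hcoe : ∀ t : S, R.g (fun i => ((pad n ⟨R.one, h1⟩ t ⟨R.one, h1⟩ i : S) : A)) = t := by
    intro t
    conv_rhs => rw [← R.pad_one_right (t : A), R.pad_comm]
    congr 1
    funext j
    simp only [pad]
    split_ifs <;> rfl
  have key : ∀ (y : A) (t : S),
      R.fracOne S hS h1 = R.fracG S hS h1 (pad n (R.mkFrac S hS h1 x ⟨R.one, h1⟩)
        (R.mkFrac S hS h1 y t) (R.fracOne S hS h1)) ↔ ∃ u ∈ S, u * (t : A) = u * (x * y) := by
    intro y t
    rw [fracOne, fracG_pad_mkFrac, mkFrac_eq_iff]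
    refine exists_congr fun u => and_congr_right fun _ => ?_
    dsimp only
    rw [hcoe]
    change u * (1 * (t : A)) = u * (x * y * 1) ↔ _
    rw [one_mul, mul_one]
  constructor
  · rintro ⟨β, hβ⟩
    obtain ⟨⟨y, t⟩, rfl⟩ := Quotient.exists_rep β
    obtain ⟨u, hu, e⟩ := (key y t).1 hβ
    -- The cofactor must include `u`, since cancellation is unavailable: `x * (u * y) = u * (x * y)
    -- = u * t`, a product of elements of `S`.
    refine ⟨u * y, ?_⟩
    change x * (u * y) ∈ S
    rw [mul_left_comm, ← e]
    exact hS.mul_mem hu t.2 h1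
  · rintro ⟨y, hy⟩
    -- The inverse of `x/1` is `y/(x * y)`.
    exact ⟨_, (key y ⟨_, hy⟩).2 ⟨R.one, h1, rfl⟩⟩

theorem subset_saturation {S : Set A} (hS : R.IsMultiplicative S) (h1 : R.one ∈ S) :
    S ⊆ R.saturation S hS h1 := fun x hx =>
  (mem_saturation_iff hS h1 x).2 ⟨R.one, by rwa [R.pad_one_right]⟩

/-- If each `s i * y i` lies in `S`, so does their product, and commutativity regroups it as `g s *
g y`. -/
theorem isMultiplicative_saturation {S : Set A} (hS : R.IsMultiplicative S) (h1 : R.one ∈ S) :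
    R.IsMultiplicative (R.saturation S hS h1) := by
  let _ := R.toCommMonoid
  refine ⟨⟨R.one, subset_saturation hS h1 h1⟩, fun s hs => ?_⟩
  choose y hy using fun i => (mem_saturation_iff hS h1 (s i)).1 (hs i)
  refine (mem_saturation_iff hS h1 _).2 ⟨R.g y, ?_⟩
  have e : R.g (pad n (R.g s) (R.g y) R.one) = R.g fun i => R.g (pad n (s i) (y i) R.one) := by
    change R.g s * R.g y = R.g fun i => s i * y i
    simp only [R.g_eq_prod, Finset.prod_mul_distrib]
  rw [e]
  exact hS.2 _ hy

theorem IsHyperideal.mul_mem {Q : Set A} (hQ : R.IsHyperideal Q) {q : A} (hq : q ∈ Q) (x : A) :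
    R.g (pad n q x R.one) ∈ Q := by
  have hn := R.two_le_n
  have h := hQ.2 (pad n q x R.one) ⟨0, by omega⟩ q hq
  rwa [Function.update_eq_self_iff.2 (by simp [pad])] at h

/-- Absorption passes to intersections of hyperideals, including the empty one; nothing else about
the radical is needed. -/
theorem mul_mem_rad {Q : Set A} {q : A} (hq : q ∈ R.rad Q) (x : A) :
    R.g (pad n q x R.one) ∈ R.rad Q :=
  fun P hP => hP.1.1.mul_mem (hq P hP) x

/-- Lets the cofactor `y` be pulled out of the slot where `s * y` replaces `a i`. -/
theorem g_update_mul (a : Fin n → A) (i : Fin n) (x y : A) :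
    R.g (Function.update a i (R.g (pad n x y R.one))) =
      R.g (pad n (R.g (Function.update a i x)) y R.one) := by
  let _ := R.toCommMonoid
  change R.g (Function.update a i (x * y)) = R.g (Function.update a i x) * y
  simp only [R.g_eq_prod, Finset.prod_update_of_mem (Finset.mem_univ i)]
  exact mul_right_comm _ _ _

/-- A common element would have a multiple in `S`, which `Q` absorbs, contradicting disjointness. -/
theorem inter_saturation_eq_empty {S Q : Set A} (hS : R.IsMultiplicative S) (h1 : R.one ∈ S)
    (hQ : R.IsHyperideal Q) (hQS : Q ∩ S = ∅) : Q ∩ R.saturation S hS h1 = ∅ := by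
  refine Set.eq_empty_iff_forall_notMem.2 fun x hx => ?_
  obtain ⟨y, hy⟩ := (mem_saturation_iff hS h1 x).1 hx.2
  exact Set.eq_empty_iff_forall_notMem.1 hQS _ ⟨hQ.mul_mem hx.1 y, hy⟩

end KrasnerHyperring

end NaryHyper

open NaryHyper NaryHyper.KrasnerHyperring in
theorem theorem24 {m n : ℕ} {A : Type*} (R : NaryHyper.KrasnerHyperring m n A)
    (S Q : Set A) (hS : R.IsMultiplicative S) (hQ : R.IsHyperideal Q)
    (h1 : R.one ∈ S) (hSQ : S ∩ Q = ∅) :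
    R.IsWeaklyPrimary S Q ↔ R.IsWeaklyPrimary (R.saturation S hS h1) Q := by
  have hQS : Q ∩ S = ∅ := by rwa [Set.inter_comm]
  constructor
  · rintro ⟨-, -, -, s, hs, h⟩
    exact ⟨hQ, isMultiplicative_saturation hS h1, inter_saturation_eq_empty hS h1 hQ hQS,
      s, subset_saturation hS h1 hs, h⟩
  · rintro ⟨-, -, -, s, hs, h⟩
    obtain ⟨y, hy⟩ := (mem_saturation_iff hS h1 s).1 hs
    -- The new witness is `s * y`; the index `i` and the alternative are those obtained for `s`.
    refine ⟨hQ, hS, hQS, _, hy, fun a ha0 haQ => ?_⟩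
    obtain ⟨i, hi⟩ := h a ha0 haQ
    refine ⟨i, hi.imp (fun hi => ?_) fun hi => ?_⟩
    · have e : R.g (pad n (R.g (pad n s y R.one)) (a i) R.one) =
          R.g (pad n (R.g (pad n s (a i) R.one)) y R.one) := by
        rw [R.pad_assoc, R.pad_comm y, ← R.pad_assoc]
      rw [e]
      exact hQ.mul_mem hi y
    · rw [g_update_mul]
      exact mul_mem_rad hi y
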